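/- For every real number $s$ with $1/2 \leq s < 1$ there is a constant $C = C(s) \geq 1$, depending only on $s$, such that the following holds. Let $P \subset \mathbb{R}^{2}$ be a set of $n$ points, where $n \geq 2$ is an integer. For $e$ in the unit circle $S^{1} = \{x \in \mathbb{R}^{2} : |x| = 1\}$, write $P_{e} := \{x \cdot e : x \in P\} \subset \mathbb{R}$ for the orthogonal projection of $P$ in the direction $e$. Then the set $\{e \in S^{1} : \operatorname{card} P_{e} \leq n^{s}\}$ is finite and $$\operatorname{card}\{e \in S^{1} : \operatorname{card} P_{e} \leq n^{s}\} \leq C\, n^{2s-1}.$$ -/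

import Mathlib

/-- The Euclidean plane. -/
abbrev Plane : Type := EuclideanSpace ℝ (Fin 2)

/-- The orthogonal projection onto the line spanned by a unit vector `e`, regarded as a map
to the real line: `x ↦ x · e`. -/
noncomputable def proj (e x : Plane) : ℝ := inner ℝ x e

/-- The projection `P_e` of a finite planar set `P` in the direction `e`. -/
noncomputable def projSet (P : Finset Plane) (e : Plane) : Finset ℝ :=
  P.image (proj e)

/-- The set of directions `e` in the unit circle for which `P_e` has at most `n ^ s` elements,
where `n` is the number of points of `P`. -/
def smallProjDirections (P : Finset Plane) (s : ℝ) : Set Plane :=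
  {e | e ∈ Metric.sphere (0 : Plane) 1 ∧ ((projSet P e).card : ℝ) ≤ (P.card : ℝ) ^ s}

/-! If `P` has few projections in direction `e`, it lies on few parallel lines orthogonal to `e`. A
shear makes the abscissas distinct and turns directions into slopes. Let N slopes be given, the n
points lying on at most K ≤ (1 - δ)n lines of each slope. Joining consecutive points on these lines
yields at least n - K ≥ δn edges per slope. Two edges cross only where two of the at most NK lines
meet, so there are at most (NK)² crossings. A graph with that many edges must have many crossings,
which forces N = O(K²/n) unless N = O(1) (`card_slopes_le`); K = ⌊n^s⌋ gives n^(2s-1).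

The crossing inequality `crossing_lemma` averages `card_le_add_crossings` over random vertex
subsets. The linear bound behind it, `card_le_of_plane`, avoids Euler's formula: each edge is
charged to an endpoint or to a vertex directly above it. -/

/-- The height at abscissa `x` of the line through the two endpoints of `e`. -/
noncomputable def lineHeight (e : (ℝ × ℝ) × (ℝ × ℝ)) (x : ℝ) : ℝ :=
  e.1.2 + (e.2.2 - e.1.2) / (e.2.1 - e.1.1) * (x - e.1.1)

/-- The slope of the line through the two endpoints of `e`. -/
noncomputable def edgeSlope (e : (ℝ × ℝ) × (ℝ × ℝ)) : ℝ :=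
  (e.2.2 - e.1.2) / (e.2.1 - e.1.1)

/-- The abscissa `x` lies strictly between those of the endpoints of `e`. -/
def Spans (e : (ℝ × ℝ) × (ℝ × ℝ)) (x : ℝ) : Prop := e.1.1 < x ∧ x < e.2.1

/-- The open segments `e` and `f` have a common point. -/
def Cross (e f : (ℝ × ℝ) × (ℝ × ℝ)) : Prop :=
  ∃ x, Spans e x ∧ Spans f x ∧ lineHeight e x = lineHeight f x

/-- A graph drawn in the plane with straight edges: edges point to the right, vertices have
distinct abscissas, and no vertex lies in the interior of an edge. -/
structure IsSegmentGraph (V : Finset (ℝ × ℝ)) (E : Finset ((ℝ × ℝ) × (ℝ × ℝ))) : Prop where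
  left_mem : ∀ e ∈ E, e.1 ∈ V
  right_mem : ∀ e ∈ E, e.2 ∈ V
  lt : ∀ e ∈ E, e.1.1 < e.2.1
  injOn : Set.InjOn Prod.fst (V : Set (ℝ × ℝ))
  avoid : ∀ e ∈ E, ∀ v ∈ V, Spans e v.1 → lineHeight e v.1 ≠ v.2

lemma lineHeight_left (e : (ℝ × ℝ) × (ℝ × ℝ)) : lineHeight e e.1.1 = e.1.2 := by
  simp [lineHeight]

lemma lineHeight_right {e : (ℝ × ℝ) × (ℝ × ℝ)} (h : e.1.1 < e.2.1) :
    lineHeight e e.2.1 = e.2.2 := by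
  have : e.2.1 - e.1.1 ≠ 0 := by linarith
  unfold lineHeight
  field_simp
  ring

lemma lineHeight_eq_add (e : (ℝ × ℝ) × (ℝ × ℝ)) (x y : ℝ) :
    lineHeight e y = lineHeight e x + edgeSlope e * (y - x) := by
  unfold lineHeight edgeSlope
  ring

lemma continuous_lineHeight (e : (ℝ × ℝ) × (ℝ × ℝ)) : Continuous (lineHeight e) := by
  unfold lineHeight
  fun_prop

lemma cross_of_lt {e f : (ℝ × ℝ) × (ℝ × ℝ)} {x y : ℝ} (hxy : x < y)
    (he : e.1.1 ≤ x) (hf : f.1.1 ≤ x) (he' : y ≤ e.2.1) (hf' : y ≤ f.2.1)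
    (h : lineHeight e x < lineHeight f x) (h' : lineHeight f y < lineHeight e y) :
    Cross e f := by
  have hc : ContinuousOn (fun z => lineHeight e z - lineHeight f z) (Set.Icc x y) :=
    ((continuous_lineHeight e).sub (continuous_lineHeight f)).continuousOn
  have h0 : (0 : ℝ) ∈ Set.Ioo (lineHeight e x - lineHeight f x)
      (lineHeight e y - lineHeight f y) := ⟨by linarith, by linarith⟩
  obtain ⟨z, ⟨hz1, hz2⟩, hz⟩ := intermediate_value_Ioo hxy.le hc h0
  exact ⟨z, ⟨by linarith, by linarith⟩, ⟨by linarith, by linarith⟩, by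
    simpa [sub_eq_zero] using hz⟩

/-! ### Plane straight-line graphs have linearly many edges -/

namespace IsSegmentGraph

variable {V : Finset (ℝ × ℝ)} {E : Finset ((ℝ × ℝ) × (ℝ × ℝ))}

lemma mono (hG : IsSegmentGraph V E) {V' : Finset (ℝ × ℝ)} {E' : Finset ((ℝ × ℝ) × (ℝ × ℝ))}
    (hV : V' ⊆ V) (hE : E' ⊆ E) (hl : ∀ e ∈ E', e.1 ∈ V') (hr : ∀ e ∈ E', e.2 ∈ V') :
    IsSegmentGraph V' E' where
  left_mem := hl
  right_mem := hr
  lt e he := hG.lt e (hE he)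
  injOn := hG.injOn.mono (by exact_mod_cast hV)
  avoid e he v hv := hG.avoid e (hE he) v (hV hv)

/-- `v` lies above `e`, and `e` is the first edge met when going down from `v`. -/
def IsFirstBelow (E : Finset ((ℝ × ℝ) × (ℝ × ℝ))) (e : (ℝ × ℝ) × (ℝ × ℝ)) (v : ℝ × ℝ) : Prop :=
  Spans e v.1 ∧ lineHeight e v.1 < v.2 ∧
    ∀ f ∈ E, Spans f v.1 → lineHeight f v.1 < v.2 → lineHeight f v.1 ≤ lineHeight e v.1

lemma cross_of_left_eq {e f : (ℝ × ℝ) × (ℝ × ℝ)} (he : e.1.1 < e.2.1) (hf : f.1.1 < f.2.1)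
    (h : e.1 = f.1) (hs : edgeSlope e = edgeSlope f) : Cross e f := by
  obtain ⟨x, hx1, hx2⟩ := exists_between (lt_min he (h ▸ hf : e.1.1 < f.2.1))
  have hx3 := lt_min_iff.1 hx2
  refine ⟨x, ⟨hx1, hx3.1⟩, ⟨h ▸ hx1, hx3.2⟩, ?_⟩
  rw [lineHeight_eq_add e e.1.1 x, lineHeight_eq_add f f.1.1 x, lineHeight_left, lineHeight_left,
    hs, h]

lemma cross_of_right_eq {e f : (ℝ × ℝ) × (ℝ × ℝ)} (he : e.1.1 < e.2.1) (hf : f.1.1 < f.2.1)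
    (h : e.2 = f.2) (hs : edgeSlope e = edgeSlope f) : Cross e f := by
  obtain ⟨x, hx1, hx2⟩ := exists_between (max_lt he (h ▸ hf : f.1.1 < e.2.1))
  have hx3 := max_lt_iff.1 hx1
  refine ⟨x, ⟨hx3.1, hx2⟩, ⟨hx3.2, h ▸ hx2⟩, ?_⟩
  rw [lineHeight_eq_add e e.2.1 x, lineHeight_eq_add f f.2.1 x, lineHeight_right he,
    lineHeight_right hf, hs, h]

/-- In a plane graph, an edge `e` which is neither the topmost edge leaving its left endpoint nor
the topmost edge arriving at its right endpoint is the first edge below some vertex. -/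
lemma exists_isFirstBelow (hG : IsSegmentGraph V E)
    (hplane : ∀ e ∈ E, ∀ f ∈ E, Cross e f → e = f) {e f g : (ℝ × ℝ) × (ℝ × ℝ)}
    (he : e ∈ E) (hf : f ∈ E) (hg : g ∈ E) (hef : f.1 = e.1) (hef' : edgeSlope e < edgeSlope f)
    (heg : g.2 = e.2) (heg' : edgeSlope g < edgeSlope e) :
    ∃ v ∈ V, IsFirstBelow E e v := by
  classical
  -- replace `f` by the lowest edge above `e` leaving the left endpoint of `e`
  obtain ⟨f, hfm, hfmin⟩ := Finset.exists_min_image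
    (E.filter fun f => f.1 = e.1 ∧ edgeSlope e < edgeSlope f) edgeSlope
    ⟨f, by simp [hf, hef, hef']⟩
  clear hf hef hef'
  simp only [Finset.mem_filter] at hfm hfmin
  obtain ⟨hf, hef, hef'⟩ := hfm
  have lte := hG.lt e he
  have ltf := hG.lt f hf
  have ltg := hG.lt g hg
  have hle : ∀ x, lineHeight e x = e.1.2 + edgeSlope e * (x - e.1.1) := fun x => by
    rw [lineHeight_eq_add e e.1.1 x, lineHeight_left]
  have hlf : ∀ x, lineHeight f x = e.1.2 + edgeSlope f * (x - e.1.1) := fun x => by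
    rw [lineHeight_eq_add f f.1.1 x, lineHeight_left, hef]
  have hlg : ∀ x, lineHeight g x = e.2.2 + edgeSlope g * (x - e.2.1) := fun x => by
    rw [lineHeight_eq_add g g.2.1 x, lineHeight_right ltg, heg]
  have hle' : ∀ x, lineHeight e x = e.2.2 + edgeSlope e * (x - e.2.1) := fun x => by
    rw [lineHeight_eq_add e e.2.1 x, lineHeight_right lte]
  have hef_lt : ∀ x, e.1.1 < x → lineHeight e x < lineHeight f x := fun x hx => by
    rw [hle, hlf]; nlinarith
  have heg_lt : ∀ x, x < e.2.1 → lineHeight e x < lineHeight g x := fun x hx => by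
    rw [hle', hlg]; nlinarith
  -- The vertices in the wedge between `e` and `f`. Below the leftmost one no edge can lie above
  -- `e`: it would cross `e` or `f`, start in the wedge further left, or leave `e.1` with a slope
  -- between those of `e` and `f`.
  let S := V.filter fun v =>
    e.1.1 < v.1 ∧ v.1 < e.2.1 ∧ v.1 ≤ f.2.1 ∧ lineHeight e v.1 < v.2 ∧ v.2 ≤ lineHeight f v.1
  have hS : S.Nonempty := by
    rcases lt_trichotomy f.2.1 e.2.1 with h | h | h
    · refine ⟨f.2, Finset.mem_filter.2 ⟨hG.right_mem f hf, ?_, h, le_rfl, ?_, ?_⟩⟩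
      · rw [← hef]; exact ltf
      · rw [← lineHeight_right ltf]
        exact hef_lt _ (by rw [← hef]; exact ltf)
      · rw [lineHeight_right ltf]
    · have h2 : f.2 = e.2 := hG.injOn (hG.right_mem f hf) (hG.right_mem e he) h
      have : f = e := Prod.ext hef h2
      subst this
      exact absurd hef' (lt_irrefl _)
    -- Here `f` passes above `e.2`, so `g` ends below `f`. As `g` cannot cross `f`, it must start
    -- inside the wedge.
    · have hfb : lineHeight g e.2.1 < lineHeight f e.2.1 := by
        rw [show lineHeight g e.2.1 = lineHeight e e.2.1 by rw [hlg, hle']; ring]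
        exact hef_lt _ lte
      have hgf : g ≠ f := by
        rintro rfl
        rw [heg] at h
        exact lt_irrefl _ h
      rcases lt_trichotomy g.1.1 e.1.1 with h' | h' | h'
      · refine absurd (hplane f hf g hg (cross_of_lt lte (by rw [hef]) h'.le h.le (by rw [heg])
          ?_ hfb)) hgf.symm
        rw [show lineHeight f e.1.1 = lineHeight e e.1.1 by rw [hlf, hle]; ring]
        exact heg_lt _ lte
      · have h2 : g.1 = e.1 := hG.injOn (hG.left_mem g hg) (hG.left_mem e he) h'
        have : g = e := Prod.ext h2 heg
        subst this
        exact absurd heg' (lt_irrefl _)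
      · have hgb : g.1.1 < e.2.1 := by rw [← heg]; exact ltg
        refine ⟨g.1, Finset.mem_filter.2 ⟨hG.left_mem g hg, h', hgb, by linarith, ?_, ?_⟩⟩
        · rw [← lineHeight_left g]
          exact heg_lt _ hgb
        · by_contra! hlt
          rw [← lineHeight_left g] at hlt
          exact hgf.symm (hplane f hf g hg (cross_of_lt hgb (by rw [hef]; exact h'.le) le_rfl
            h.le (by rw [heg]) hlt hfb))
  obtain ⟨v, hvS, hvmin⟩ := Finset.exists_min_image S Prod.fst hS
  obtain ⟨hvV, hv1, hv2, hv3, hv4, hv5⟩ := Finset.mem_filter.1 hvS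
  refine ⟨v, hvV, ⟨hv1, hv2⟩, hv4, fun k hk hkv hkv' => ?_⟩
  by_contra! hlt
  have hek : e ≠ k := by
    rintro rfl
    exact lt_irrefl _ hlt
  have hfk : f ≠ k := by
    rintro rfl
    linarith
  rcases lt_trichotomy k.1.1 e.1.1 with h | h | h
  · -- `k` passes above or below the left endpoint of `e`
    have hne := hG.avoid k hk e.1 (hG.left_mem e he) ⟨h, hv1.trans hkv.2⟩
    rcases lt_or_gt_of_ne hne with h' | h'
    · exact hek.symm (hplane k hk e he (cross_of_lt hv1 h.le le_rfl hkv.2.le hv2.le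
        (by rwa [lineHeight_left]) hlt))
    · refine hfk (hplane f hf k hk (cross_of_lt hv1 (by rw [hef]) h.le hv3 hkv.2.le ?_
        (by linarith)))
      rwa [← hef, lineHeight_left, hef]
  · have h2 : k.1 = e.1 := hG.injOn (hG.left_mem k hk) (hG.left_mem e he) h
    have hlk : ∀ x, lineHeight k x = e.1.2 + edgeSlope k * (x - e.1.1) := fun x => by
      rw [lineHeight_eq_add k k.1.1 x, lineHeight_left, h2]
    have h3 : edgeSlope e < edgeSlope k := by
      rw [hlk, hle] at hlt
      by_contra! h'
      nlinarith
    have h4 := hfmin k ⟨hk, h2, h3⟩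
    have h5 : lineHeight k v.1 < lineHeight f v.1 := by linarith
    rw [hlk, hlf] at h5
    nlinarith
  · -- the left endpoint of `k` is a vertex of `S` to the left of `v`
    have hkb : k.1.1 < e.2.1 := hkv.1.trans hv2
    refine absurd (hvmin k.1 (Finset.mem_filter.2 ⟨hG.left_mem k hk, h, hkb,
      hkv.1.le.trans hv3, ?_, ?_⟩)) (not_le.2 hkv.1)
    · by_contra! h'
      have hne := hG.avoid e he k.1 (hG.left_mem k hk) ⟨h, hkb⟩
      have h6 : lineHeight k k.1.1 < lineHeight e k.1.1 := by
        rw [lineHeight_left]; exact lt_of_le_of_ne h' hne.symm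
      exact hek.symm (hplane k hk e he (cross_of_lt hkv.1 le_rfl h.le hkv.2.le hv2.le h6 hlt))
    · by_contra! h'
      rw [← lineHeight_left k] at h'
      exact hfk (hplane f hf k hk (cross_of_lt hkv.1 (by rw [hef]; exact h.le) le_rfl hv3
        hkv.2.le h' (by linarith)))

/-- A plane graph with straight edges has at most three times as many edges as vertices. -/
theorem card_le_of_plane (hG : IsSegmentGraph V E)
    (hplane : ∀ e ∈ E, ∀ f ∈ E, Cross e f → e = f) : E.card ≤ 3 * V.card := by
  classical
  let T₁ := E.filter fun e => ∀ f ∈ E, f.1 = e.1 → edgeSlope f ≤ edgeSlope e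
  -- Among edges arriving at a vertex, the smallest slope is the topmost edge.
  let T₂ := E.filter fun e => ∀ f ∈ E, f.2 = e.2 → edgeSlope e ≤ edgeSlope f
  let T₃ := E.filter fun e => ∃ v ∈ V, IsFirstBelow E e v
  have hsub : E ⊆ T₁ ∪ T₂ ∪ T₃ := by
    intro e he
    by_contra hcon
    simp only [T₁, T₂, T₃, Finset.mem_union, Finset.mem_filter, he, true_and, not_or] at hcon
    obtain ⟨⟨h1, h2⟩, h3⟩ := hcon
    push Not at h1 h2
    obtain ⟨f, hf, hf1, hf2⟩ := h1
    obtain ⟨g, hg, hg1, hg2⟩ := h2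
    exact h3 (hG.exists_isFirstBelow hplane he hf hg hf1 hf2 hg1 hg2)
  have h1 : T₁.card ≤ V.card := by
    refine Finset.card_le_card_of_injOn Prod.fst
      (fun e he => hG.left_mem e (Finset.mem_filter.1 he).1) fun e he f hf h => ?_
    obtain ⟨he, he'⟩ := Finset.mem_filter.1 he
    obtain ⟨hf, hf'⟩ := Finset.mem_filter.1 hf
    exact hplane e he f hf (cross_of_left_eq (hG.lt e he) (hG.lt f hf) h
      (le_antisymm (hf' e he h) (he' f hf h.symm)))
  have h2 : T₂.card ≤ V.card := by
    refine Finset.card_le_card_of_injOn Prod.snd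
      (fun e he => hG.right_mem e (Finset.mem_filter.1 he).1) fun e he f hf h => ?_
    obtain ⟨he, he'⟩ := Finset.mem_filter.1 he
    obtain ⟨hf, hf'⟩ := Finset.mem_filter.1 hf
    exact hplane e he f hf (cross_of_right_eq (hG.lt e he) (hG.lt f hf) h
      (le_antisymm (he' f hf h.symm) (hf' e he h)))
  have h3 : T₃.card ≤ V.card := by
    refine Finset.card_le_card_of_forall_subsingleton (IsFirstBelow E)
      (fun e he => (Finset.mem_filter.1 he).2) fun v _ => ?_
    rintro e ⟨he, he1, he2, he3⟩ f ⟨hf, hf1, hf2, hf3⟩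
    have he := (Finset.mem_filter.1 he).1
    have hf := (Finset.mem_filter.1 hf).1
    exact hplane e he f hf ⟨v.1, he1, hf1, le_antisymm (hf3 e he he1 he2) (he3 f hf hf1 hf2)⟩
  have := (Finset.card_le_card hsub).trans
    ((Finset.card_union_le _ _).trans (Nat.add_le_add_right (Finset.card_union_le _ _) _))
  omega

end IsSegmentGraph

/-! ### Crossings and a linear lower bound for their number -/

namespace IsSegmentGraph

variable {V : Finset (ℝ × ℝ)} {E : Finset ((ℝ × ℝ) × (ℝ × ℝ))}

open Classical in
/-- The ordered pairs of distinct crossing edges. -/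
noncomputable def crossings (E : Finset ((ℝ × ℝ) × (ℝ × ℝ))) :
    Finset (((ℝ × ℝ) × (ℝ × ℝ)) × ((ℝ × ℝ) × (ℝ × ℝ))) :=
  (E ×ˢ E).filter fun q => Cross q.1 q.2 ∧ q.1 ≠ q.2

lemma mem_crossings {q : ((ℝ × ℝ) × (ℝ × ℝ)) × ((ℝ × ℝ) × (ℝ × ℝ))} :
    q ∈ crossings E ↔ (q.1 ∈ E ∧ q.2 ∈ E) ∧ Cross q.1 q.2 ∧ q.1 ≠ q.2 := by
  simp [crossings]

/-- Deleting every edge involved in a crossing leaves a plane graph and costs at most one edge per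
ordered crossing pair. -/
theorem card_le_add_crossings (hG : IsSegmentGraph V E) :
    E.card ≤ 3 * V.card + (crossings E).card := by
  classical
  let E' := E \ (crossings E).image Prod.fst
  have hE' : E' ⊆ E := Finset.sdiff_subset
  have h := (hG.mono subset_rfl hE' (fun e he => hG.left_mem e (hE' he))
    (fun e he => hG.right_mem e (hE' he))).card_le_of_plane fun e he f hf hc => by
      by_contra hne
      exact (Finset.mem_sdiff.1 he).2 (Finset.mem_image.2
        ⟨(e, f), mem_crossings.2 ⟨⟨hE' he, hE' hf⟩, hc, hne⟩, rfl⟩)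
  have h2 := Finset.le_card_sdiff ((crossings E).image Prod.fst) E
  have h3 : ((crossings E).image Prod.fst).card ≤ (crossings E).card := Finset.card_image_le
  change _ ≤ E'.card at h2
  omega

/-- Two crossing edges on the same line are equal. -/
lemma eq_of_edgeSlope_eq (hG : IsSegmentGraph V E) {e f : (ℝ × ℝ) × (ℝ × ℝ)} {x : ℝ} (he : e ∈ E)
    (hf : f ∈ E) (hs : edgeSlope e = edgeSlope f) (hex : Spans e x) (hfx : Spans f x)
    (hx : lineHeight e x = lineHeight f x) : e = f := by
  -- An endpoint of `f` strictly inside the collinear edge `e` would violate `avoid`; by symmetry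
  -- the two edges span the same interval.
  have key : ∀ e ∈ E, ∀ f ∈ E, edgeSlope e = edgeSlope f → Spans e x → Spans f x →
      lineHeight e x = lineHeight f x → f.1.1 ≤ e.1.1 ∧ e.2.1 ≤ f.2.1 := by
    intro e he f hf hs hex hfx hx
    have heq : ∀ y, lineHeight e y = lineHeight f y := fun y => by
      rw [lineHeight_eq_add e x, lineHeight_eq_add f x, hs, hx]
    constructor
    · by_contra! h
      refine hG.avoid e he f.1 (hG.left_mem f hf) ⟨h, hfx.1.trans hex.2⟩ ?_
      rw [heq, lineHeight_left]
    · by_contra! h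
      refine hG.avoid e he f.2 (hG.right_mem f hf) ⟨hex.1.trans hfx.2, h⟩ ?_
      rw [heq, lineHeight_right (hG.lt f hf)]
  have h1 := key e he f hf hs hex hfx hx
  have h2 := key f hf e he hs.symm hfx hex hx.symm
  exact Prod.ext (hG.injOn (hG.left_mem e he) (hG.left_mem f hf) (le_antisymm h2.1 h1.1))
    (hG.injOn (hG.right_mem e he) (hG.right_mem f hf) (le_antisymm h1.2 h2.2))

/-- The four endpoints of two crossing edges are distinct. -/
lemma card_endpoints (hG : IsSegmentGraph V E) {e f : (ℝ × ℝ) × (ℝ × ℝ)} (he : e ∈ E) (hf : f ∈ E)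
    (hc : Cross e f) (hne : e ≠ f) : ({e.1, e.2, f.1, f.2} : Finset (ℝ × ℝ)).card = 4 := by
  obtain ⟨x, hx1, hx2, hx⟩ := hc
  have lte := hG.lt e he
  have ltf := hG.lt f hf
  have h12 : e.1 ≠ e.2 := fun h => lte.ne (by rw [h])
  have h34 : f.1 ≠ f.2 := fun h => ltf.ne (by rw [h])
  -- The lines differ, hence meet only at `x`, which is interior to both edges; a shared endpoint
  -- would be a second meeting point.
  have key : ∀ y, y ≠ x → lineHeight e y ≠ lineHeight f y := fun y hy h => by
    have hx' := hx
    rw [lineHeight_eq_add e y x, lineHeight_eq_add f y x, h] at hx'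
    exact hne (hG.eq_of_edgeSlope_eq he hf
      (mul_right_cancel₀ (sub_ne_zero.2 hy.symm) (add_left_cancel hx')) hx1 hx2 hx)
  have h13 : e.1 ≠ f.1 := fun h => key e.1.1 hx1.1.ne (by
    rw [lineHeight_left, h, lineHeight_left])
  have h24 : e.2 ≠ f.2 := fun h => key e.2.1 hx1.2.ne' (by
    rw [lineHeight_right lte, h, lineHeight_right ltf])
  have h14 : e.1 ≠ f.2 := fun h => (hx1.1.trans hx2.2).ne (by rw [h])
  have h23 : e.2 ≠ f.1 := fun h => (hx2.1.trans hx1.2).ne (by rw [h])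
  rw [Finset.card_insert_of_notMem, Finset.card_insert_of_notMem, Finset.card_pair h34] <;>
    simp [*]

end IsSegmentGraph

/-! ### Random vertex subsets and the crossing inequality -/

section RandomSubset

variable {α ι : Type*} [DecidableEq α]

/-- The probability that a random subset of `V`, to which every element belongs independently with
probability `p`, contains `T`. -/
lemma sum_powerset_superset (V T : Finset α) (hT : T ⊆ V) (p : ℝ) :
    ∑ S ∈ V.powerset, (if T ⊆ S then p ^ S.card * (1 - p) ^ (V \ S).card else 0)
      = p ^ T.card := by
  -- Giving the elements of `T` weight 0 for being left out kills exactly the terms with `T ⊄ S`.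
  have h := Finset.prod_add (fun _ : α => p) (fun i => if i ∈ T then 0 else 1 - p) V
  have hl : ∏ i ∈ V, (p + if i ∈ T then 0 else 1 - p) = p ^ T.card := by
    have h1 : ∀ i ∈ V, (p + if i ∈ T then 0 else 1 - p) = if i ∈ T then p else 1 := fun i _ => by
      split_ifs <;> ring
    rw [Finset.prod_congr rfl h1, Finset.prod_ite_mem, Finset.inter_eq_right.2 hT,
      Finset.prod_const]
  rw [← hl, h]
  refine Finset.sum_congr rfl fun S hS => ?_
  split_ifs with hTS
  · rw [Finset.prod_const, ← Finset.prod_const (1 - p)]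
    refine congrArg _ (Finset.prod_congr rfl fun i hi => ?_)
    rw [if_neg fun hiT => (Finset.mem_sdiff.1 hi).2 (hTS hiT)]
  · obtain ⟨i, hiT, hiS⟩ := Finset.not_subset.1 hTS
    rw [Finset.prod_eq_zero (i := i) (Finset.mem_sdiff.2 ⟨hT hiT, hiS⟩) (by simp [hiT]), mul_zero]

/-- Expected number of members of a family of `d`-element sets contained in a random subset. -/
lemma sum_powerset_card_filter (V : Finset α) (A : Finset ι) (t : ι → Finset α) (d : ℕ)
    (ht : ∀ a ∈ A, t a ⊆ V) (hd : ∀ a ∈ A, (t a).card = d) (p : ℝ) :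
    ∑ S ∈ V.powerset, p ^ S.card * (1 - p) ^ (V \ S).card * ((A.filter fun a => t a ⊆ S).card : ℝ)
      = A.card * p ^ d := by
  have h : ∀ a ∈ A, ∑ S ∈ V.powerset,
      (if t a ⊆ S then p ^ S.card * (1 - p) ^ (V \ S).card else 0) = p ^ d := fun a ha => by
    rw [sum_powerset_superset V _ (ht a ha), hd a ha]
  rw [← nsmul_eq_mul, ← Finset.sum_const, ← Finset.sum_congr rfl h, Finset.sum_comm]
  refine Finset.sum_congr rfl fun S _ => ?_
  rw [← Finset.sum_filter, Finset.sum_const, nsmul_eq_mul, mul_comm]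

end RandomSubset

namespace IsSegmentGraph

variable {V : Finset (ℝ × ℝ)} {E : Finset ((ℝ × ℝ) × (ℝ × ℝ))}

/-- Crossing lemma for straight-line drawings, before the choice of the probability `p`. -/
theorem crossing_lemma (hG : IsSegmentGraph V E) {p : ℝ} (hp : 0 < p) (hp1 : p ≤ 1) :
    (E.card : ℝ) * p ^ 2 ≤ 3 * (V.card * p) + (crossings E).card * p ^ 4 := by
  classical
  have hE := sum_powerset_card_filter V E (fun e => {e.1, e.2}) 2
    (fun e he => by
      simp [Finset.insert_subset_iff, hG.left_mem e he, hG.right_mem e he])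
    (fun e he => Finset.card_pair fun h => (hG.lt e he).ne (by rw [h])) p
  have hV := sum_powerset_card_filter V V (fun v => {v}) 1 (fun v hv => by simpa using hv)
    (fun v _ => Finset.card_singleton v) p
  have hX := sum_powerset_card_filter V (crossings E)
    (fun q => {q.1.1, q.1.2, q.2.1, q.2.2}) 4
    (fun q hq => by
      obtain ⟨⟨h1, h2⟩, -⟩ := mem_crossings.1 hq
      simp [Finset.insert_subset_iff, hG.left_mem _ h1, hG.right_mem _ h1, hG.left_mem _ h2,
        hG.right_mem _ h2])
    (fun q hq => by
      obtain ⟨⟨h1, h2⟩, h3, h4⟩ := mem_crossings.1 hq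
      exact hG.card_endpoints h1 h2 h3 h4) p
  rw [pow_one] at hV
  rw [← hE, ← hV, ← hX, Finset.mul_sum, ← Finset.sum_add_distrib]
  -- It remains to apply the linear bound to the subgraph induced on each `S`.
  refine Finset.sum_le_sum fun S hS => ?_
  have hSV := Finset.mem_powerset.1 hS
  set ES := E.filter fun e => ({e.1, e.2} : Finset (ℝ × ℝ)) ⊆ S with hES
  have hG' : IsSegmentGraph S ES := hG.mono hSV (Finset.filter_subset _ _)
    (fun e he => (Finset.mem_filter.1 he).2 (by simp))
    (fun e he => (Finset.mem_filter.1 he).2 (by simp))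
  have h1 := hG'.card_le_add_crossings
  have h2 : (V.filter fun v => ({v} : Finset (ℝ × ℝ)) ⊆ S) = S := by
    ext v
    simpa using @hSV v
  have h3 : crossings ES = (crossings E).filter
      fun q => ({q.1.1, q.1.2, q.2.1, q.2.2} : Finset (ℝ × ℝ)) ⊆ S := by
    ext q
    simp only [mem_crossings, hES, Finset.mem_filter, Finset.insert_subset_iff,
      Finset.singleton_subset_iff]
    tauto
  rw [h2, ← h3]
  have hw : 0 ≤ p ^ S.card * (1 - p) ^ (V \ S).card :=
    mul_nonneg (pow_nonneg hp.le _) (pow_nonneg (by linarith) _)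
  have h4 : (ES.card : ℝ) ≤ 3 * S.card + (crossings ES).card := by exact_mod_cast h1
  calc _ ≤ p ^ S.card * (1 - p) ^ (V \ S).card * (3 * S.card + (crossings ES).card) :=
        mul_le_mul_of_nonneg_left h4 hw
    _ = _ := by ring

end IsSegmentGraph

/-! ### Edges joining consecutive points on lines of given slopes -/

namespace IsSegmentGraph

open Classical in
/-- The segments with slope in `M` joining consecutive points of `V` on a line. -/
noncomputable def slopeEdges (V : Finset (ℝ × ℝ)) (M : Finset ℝ) :
    Finset ((ℝ × ℝ) × (ℝ × ℝ)) :=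
  (V ×ˢ V).filter fun e => e.1.1 < e.2.1 ∧ edgeSlope e ∈ M ∧
    ∀ v ∈ V, Spans e v.1 → lineHeight e v.1 ≠ v.2

variable {V : Finset (ℝ × ℝ)} {M : Finset ℝ}

lemma mem_slopeEdges {e : (ℝ × ℝ) × (ℝ × ℝ)} : e ∈ slopeEdges V M ↔
    (e.1 ∈ V ∧ e.2 ∈ V) ∧ e.1.1 < e.2.1 ∧ edgeSlope e ∈ M ∧
      ∀ v ∈ V, Spans e v.1 → lineHeight e v.1 ≠ v.2 := by
  simp [slopeEdges]

lemma isSegmentGraph_slopeEdges (hV : Set.InjOn Prod.fst (V : Set (ℝ × ℝ))) :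
    IsSegmentGraph V (slopeEdges V M) where
  left_mem _ he := (mem_slopeEdges.1 he).1.1
  right_mem _ he := (mem_slopeEdges.1 he).1.2
  lt _ he := (mem_slopeEdges.1 he).2.1
  injOn := hV
  avoid _ he := (mem_slopeEdges.1 he).2.2.2

lemma lineHeight_eq_intercept (e : (ℝ × ℝ) × (ℝ × ℝ)) (x : ℝ) :
    lineHeight e x = (e.1.2 - edgeSlope e * e.1.1) + edgeSlope e * x := by
  rw [lineHeight_eq_add e e.1.1 x, lineHeight_left]
  ring

/-- All points of `V` except the last one on each line of slope `m` are left endpoints of an edge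
of slope `m`. -/
lemma card_le_card_slopeEdges_filter (hV : Set.InjOn Prod.fst (V : Set (ℝ × ℝ))) {m : ℝ}
    (hm : m ∈ M) :
    V.card ≤ ((slopeEdges V M).filter fun e => edgeSlope e = m).card
      + (V.image fun v => v.2 - m * v.1).card := by
  classical
  set A := ((slopeEdges V M).filter fun e => edgeSlope e = m).image Prod.fst with hA
  have h1 : A.card ≤ ((slopeEdges V M).filter fun e => edgeSlope e = m).card :=
    Finset.card_image_le
  have key : ∀ a ∈ V, a ∉ A → ∀ b ∈ V, a.2 - m * a.1 = b.2 - m * b.1 → b.1 ≤ a.1 := by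
    intro a ha haA b hb hab
    by_contra! hlt
    -- `c` is the next point after `a` on its line, so `(a, c)` is an edge.
    obtain ⟨c, hc, hcmin⟩ := Finset.exists_min_image
      (V.filter fun c => a.1 < c.1 ∧ a.2 - m * a.1 = c.2 - m * c.1) Prod.fst
      ⟨b, by simp [hb, hlt, hab]⟩
    simp only [Finset.mem_filter] at hc hcmin
    obtain ⟨hcV, hac, hac'⟩ := hc
    have hslope : edgeSlope (a, c) = m := by
      unfold edgeSlope
      rw [div_eq_iff (sub_ne_zero.2 hac.ne')]
      linarith
    refine haA (Finset.mem_image.2 ⟨(a, c), Finset.mem_filter.2 ⟨mem_slopeEdges.2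
      ⟨⟨ha, hcV⟩, hac, by rwa [hslope], fun v hv hspan hv' => ?_⟩, hslope⟩, rfl⟩)
    rw [lineHeight_eq_intercept, hslope] at hv'
    have := hcmin v ⟨hv, hspan.1, by simp only at hv'; linarith⟩
    exact absurd hspan.2 (not_lt.2 this)
  have h2 : (V \ A).card ≤ (V.image fun v => v.2 - m * v.1).card := by
    refine Finset.card_le_card_of_injOn (fun v => v.2 - m * v.1)
      (fun v hv => Finset.mem_image_of_mem _ (Finset.mem_sdiff.1 hv).1) fun a ha b hb hab => ?_
    obtain ⟨ha, ha'⟩ := Finset.mem_sdiff.1 ha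
    obtain ⟨hb, hb'⟩ := Finset.mem_sdiff.1 hb
    exact hV ha hb (le_antisymm (key b hb hb' a ha hab.symm) (key a ha ha' b hb hab))
  have h3 : V.card ≤ A.card + (V \ A).card := by
    have := Finset.le_card_sdiff A V
    omega
  omega

lemma card_mul_le_card_slopeEdges (hV : Set.InjOn Prod.fst (V : Set (ℝ × ℝ))) {K : ℕ}
    (hK : ∀ m ∈ M, (V.image fun v => v.2 - m * v.1).card ≤ K) :
    M.card * V.card ≤ (slopeEdges V M).card + M.card * K := by
  rw [Finset.card_eq_sum_card_fiberwise (f := edgeSlope) (t := M)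
    fun e he => (mem_slopeEdges.1 he).2.2.1, ← smul_eq_mul, ← smul_eq_mul, ← Finset.sum_const,
    ← Finset.sum_const, ← Finset.sum_add_distrib]
  exact Finset.sum_le_sum fun m hm =>
    (card_le_card_slopeEdges_filter hV hm).trans (Nat.add_le_add_left (hK m hm) _)

/-- Two distinct lines meet at most once, and each of them has at most one edge through the
intersection point. -/
lemma card_crossings_slopeEdges_le (hV : Set.InjOn Prod.fst (V : Set (ℝ × ℝ))) {K : ℕ}
    (hK : ∀ m ∈ M, (V.image fun v => v.2 - m * v.1).card ≤ K) :
    (crossings (slopeEdges V M)).card ≤ (M.card * K) ^ 2 := by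
  classical
  have hG := isSegmentGraph_slopeEdges (M := M) hV
  let L : Finset (ℝ × ℝ) :=
    M.biUnion fun m => (V.image fun v => v.2 - m * v.1).image (Prod.mk m)
  let l : (ℝ × ℝ) × (ℝ × ℝ) → ℝ × ℝ := fun e => (edgeSlope e, e.1.2 - edgeSlope e * e.1.1)
  have hl : ∀ e ∈ slopeEdges V M, l e ∈ L := fun e he => by
    have h := mem_slopeEdges.1 he
    exact Finset.mem_biUnion.2 ⟨edgeSlope e, h.2.2.1, Finset.mem_image_of_mem _
      (Finset.mem_image_of_mem (fun v : ℝ × ℝ => v.2 - edgeSlope e * v.1) h.1.1)⟩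
  have hL : L.card ≤ M.card * K := Finset.card_biUnion_le_card_mul _ _ _ fun m hm =>
    Finset.card_image_le.trans (hK m hm)
  have heq : ∀ e f, l e = l f → ∀ x, lineHeight e x = lineHeight f x := fun e f h x => by
    obtain ⟨h1, h2⟩ := Prod.ext_iff.1 h
    rw [lineHeight_eq_intercept, lineHeight_eq_intercept f]
    simp only [l] at h1 h2
    rw [h2, h1]
  calc (crossings (slopeEdges V M)).card ≤ (L ×ˢ L).card := by
        -- The pair of lines determines the crossing point, and that point is interior to only one
        -- edge on each line.
        refine Finset.card_le_card_of_injOn (fun q => (l q.1, l q.2)) (fun q hq => ?_) ?_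
        · have h := (mem_crossings.1 hq).1
          exact Finset.mem_product.2 ⟨hl _ h.1, hl _ h.2⟩
        · rintro ⟨e, f⟩ hq ⟨e', f'⟩ hq' h
          obtain ⟨⟨he, hf⟩, ⟨x, hx1, hx2, hx⟩, hne⟩ := mem_crossings.1 hq
          obtain ⟨⟨he', hf'⟩, ⟨y, hy1, hy2, hy⟩, -⟩ := mem_crossings.1 hq'
          obtain ⟨h1, h2⟩ := Prod.ext_iff.1 h
          simp only at he hf hx1 hx2 hx hne he' hf' hy1 hy2 hy h1 h2
          have hxy : x = y := by
            by_contra hxy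
            have hy' : lineHeight e y = lineHeight f y := by rw [heq e e' h1, heq f f' h2, hy]
            rw [lineHeight_eq_add e x y, lineHeight_eq_add f x y, hx] at hy'
            exact hne (hG.eq_of_edgeSlope_eq he hf (mul_right_cancel₀
              (sub_ne_zero.2 (Ne.symm hxy)) (add_left_cancel hy')) hx1 hx2 hx)
          subst hxy
          exact Prod.ext
            (hG.eq_of_edgeSlope_eq he he' (Prod.ext_iff.1 h1).1 hx1 hy1 (heq e e' h1 x))
            (hG.eq_of_edgeSlope_eq hf hf' (Prod.ext_iff.1 h2).1 hx2 hy2 (heq f f' h2 x))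
    _ = L.card ^ 2 := by rw [Finset.card_product, sq]
    _ ≤ (M.card * K) ^ 2 := Nat.pow_le_pow_left hL 2

/-- If at least two points are given, with distinct abscissas, then few slopes `m` have the
property that the points lie on few lines of slope `m`. -/
theorem card_slopes_le (hV : Set.InjOn Prod.fst (V : Set (ℝ × ℝ))) {K : ℕ} {δ : ℝ} (hδ : 0 < δ)
    (hV0 : 0 < V.card) (hKV : (K : ℝ) ≤ (1 - δ) * V.card)
    (hK : ∀ m ∈ M, (V.image fun v => v.2 - m * v.1).card ≤ K) :
    (M.card : ℝ) ≤ 6 / δ ∨ (M.card : ℝ) ≤ 72 / δ ^ 3 * ((K : ℝ) ^ 2 / V.card) := by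
  rcases le_or_gt (M.card : ℝ) (6 / δ) with h | h
  · exact Or.inl h
  right
  have hn : (0 : ℝ) < V.card := by exact_mod_cast hV0
  have hN : (0 : ℝ) < M.card := (by positivity : (0 : ℝ) < 6 / δ).trans h
  have hδN : 6 < δ * M.card := by rwa [div_lt_iff₀ hδ, mul_comm] at h
  have hE : (M.card : ℝ) * V.card ≤ (slopeEdges V M).card + M.card * K := by
    exact_mod_cast card_mul_le_card_slopeEdges hV hK
  have hX : ((crossings (slopeEdges V M)).card : ℝ) ≤ (M.card * K) ^ 2 := by
    exact_mod_cast card_crossings_slopeEdges_le hV hK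
  -- With p = 6/(δN) the vertex term 3np is half of the lower bound δnNp² = 6np. The condition p ≤ 1
  -- is what the alternative N ≤ 6/δ secures.
  have hp0 : 0 < 6 / (δ * M.card) := by positivity
  have hp1 : 6 / (δ * M.card) ≤ 1 := (div_le_one (by positivity)).2 hδN.le
  have hcr := (isSegmentGraph_slopeEdges (M := M) hV).crossing_lemma hp0 hp1
  generalize ((slopeEdges V M).card : ℝ) = e at *
  generalize ((crossings (slopeEdges V M)).card : ℝ) = X at *
  generalize (M.card : ℝ) = N at *
  generalize (V.card : ℝ) = n at *
  generalize (K : ℝ) = k at *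
  have hE' : δ * n * N ≤ e := by nlinarith
  have h1 : δ * n * N * (6 / (δ * N)) ^ 2
      ≤ 3 * (n * (6 / (δ * N))) + (N * k) ^ 2 * (6 / (δ * N)) ^ 4 :=
    (mul_le_mul_of_nonneg_right hE' (by positivity)).trans
      (hcr.trans (by gcongr))
  have h2 : δ * n * N * (6 / (δ * N)) ^ 2 = 36 * n / (δ * N) := by field_simp; norm_num
  have h3 : 3 * (n * (6 / (δ * N))) = 18 * n / (δ * N) := by field_simp; norm_num
  have h4 : (N * k) ^ 2 * (6 / (δ * N)) ^ 4 = 1296 * k ^ 2 / (δ ^ 3 * N) / (δ * N) := by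
    field_simp; norm_num
  rw [h2, h3, h4, ← add_div, div_le_div_iff_of_pos_right (by positivity)] at h1
  have h5 : 18 * n ≤ 1296 * k ^ 2 / (δ ^ 3 * N) := by linarith
  rw [le_div_iff₀ (by positivity)] at h5
  rw [div_mul_div_comm, le_div_iff₀ (by positivity)]
  linarith

end IsSegmentGraph

/-! ### From directions to slopes -/

lemma proj_eq (e x : Plane) : proj e x = x 0 * e 0 + x 1 * e 1 := by
  simp [proj, PiLp.inner_apply, Fin.sum_univ_two, mul_comm]

lemma sq_add_sq_eq_one_of_mem_sphere {e : Plane} (he : e ∈ Metric.sphere (0 : Plane) 1) :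
    e 0 ^ 2 + e 1 ^ 2 = 1 := by
  have h : ‖e‖ = 1 := by simpa using he
  have h2 := EuclideanSpace.real_norm_sq_eq e
  rw [h, Fin.sum_univ_two] at h2
  linarith

/-- The points of a finite planar set have distinct first coordinates after a suitable shear. -/
lemma exists_shear_injOn (P : Finset Plane) :
    ∃ τ : ℝ, Set.InjOn (fun x : Plane => x 0 + τ * x 1) (P : Set Plane) := by
  classical
  obtain ⟨τ, hτ⟩ := Infinite.exists_notMem_finset
    ((P ×ˢ P).image fun q => -(q.1 0 - q.2 0) / (q.1 1 - q.2 1))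
  refine ⟨τ, fun x hx y hy hxy => ?_⟩
  simp only at hxy
  have h1 : x 1 = y 1 := by
    by_contra hne
    refine hτ (Finset.mem_image.2 ⟨(x, y), Finset.mem_product.2 ⟨hx, hy⟩, ?_⟩)
    rw [div_eq_iff (sub_ne_zero.2 hne)]
    linarith
  ext i
  fin_cases i
  · simpa [h1] using hxy
  · exact h1

/-- Two unit vectors spanning the same line are equal or opposite. -/
lemma eq_or_eq_neg_of_mul_eq {e f : Plane} (he : e ∈ Metric.sphere (0 : Plane) 1)
    (hf : f ∈ Metric.sphere (0 : Plane) 1) (h : e 0 * f 1 = f 0 * e 1) : e = f ∨ e = -f := by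
  have he := sq_add_sq_eq_one_of_mem_sphere he
  have hf := sq_add_sq_eq_one_of_mem_sphere hf
  set c := e 0 * f 0 + e 1 * f 1 with hc
  have h0 : e 0 = c * f 0 := by rw [hc]; linear_combination (-e 0) * hf + f 1 * h
  have h1 : e 1 = c * f 1 := by rw [hc]; linear_combination (-e 1) * hf - f 0 * h
  have hc2 : c ^ 2 = 1 := by
    rw [h0, h1] at he
    linear_combination he - c ^ 2 * hf
  rcases sq_eq_sq_iff_eq_or_eq_neg.1 (hc2.trans (one_pow 2).symm) with h | h
  · left
    ext i
    fin_cases i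
    · simpa [h] using h0
    · simpa [h] using h1
  · right
    ext i
    fin_cases i
    · simpa [h] using h0
    · simpa [h] using h1

/-- The bound for finite sets of directions. -/
lemma card_directions_le {s δ : ℝ} (hs : 1 / 2 ≤ s) (hδ : δ = 1 - 2 ^ (s - 1)) (hδ0 : 0 < δ)
    {P : Finset Plane} (hP : 2 ≤ P.card) (F : Finset Plane)
    (hF : (F : Set Plane) ⊆ smallProjDirections P s) :
    (F.card : ℝ) ≤ 2 * (6 / δ + 72 / δ ^ 3) * (P.card : ℝ) ^ (2 * s - 1) := by
  classical
  obtain ⟨τ, hτ⟩ := exists_shear_injOn P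
  have hn : (2 : ℝ) ≤ P.card := by exact_mod_cast hP
  have hn0 : (0 : ℝ) < P.card := by linarith
  have hs1 : s < 1 := by
    by_contra! h
    have := Real.one_le_rpow (x := 2) one_le_two (sub_nonneg.2 h)
    linarith
  have hns : (P.card : ℝ) ^ s ≤ (1 - δ) * P.card := by
    have h1 : (P.card : ℝ) ^ s = (P.card : ℝ) ^ (s - 1) * P.card := by
      rw [← Real.rpow_add_one hn0.ne', sub_add_cancel]
    rw [h1, hδ, sub_sub_cancel]
    exact mul_le_mul_of_nonneg_right
      (Real.rpow_le_rpow_of_nonpos two_pos hn (by linarith)) hn0.le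
  -- An exceptional direction would become vertical; the projection is then injective on `P`,
  -- contradicting n^s ≤ (1 - δ)n < n.
  have hβ : ∀ e ∈ F, e 1 - τ * e 0 ≠ 0 := by
    intro e he h0
    obtain ⟨he1, he2⟩ := hF he
    have hsq := sq_add_sq_eq_one_of_mem_sphere he1
    have h1 : e 1 = τ * e 0 := by linarith
    have he0 : e 0 ≠ 0 := by
      intro h
      rw [h1, h] at hsq
      norm_num at hsq
    have hcard : (projSet P e).card = P.card := by
      refine Finset.card_image_of_injOn fun x hx y hy hxy => hτ hx hy ?_
      rw [proj_eq, proj_eq, h1] at hxy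
      refine mul_right_cancel₀ he0 ?_
      simp only
      linarith
    rw [hcard] at he2
    nlinarith
  let V : Finset (ℝ × ℝ) := P.image fun x => (x 0 + τ * x 1, x 1)
  have hVinj : Set.InjOn (fun x : Plane => (x 0 + τ * x 1, x 1)) (P : Set Plane) :=
    fun x hx y hy h => hτ hx hy (Prod.ext_iff.1 h).1
  have hVcard : V.card = P.card := Finset.card_image_of_injOn hVinj
  have hV : Set.InjOn Prod.fst (V : Set (ℝ × ℝ)) := by
    intro v hv w hw h
    obtain ⟨x, hx, rfl⟩ := Finset.mem_image.1 hv
    obtain ⟨y, hy, rfl⟩ := Finset.mem_image.1 hw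
    rw [hτ hx hy h]
  -- Chosen so that x · e = (e₁ - τe₀)(v₂ - μv₁) for the sheared point v of x.
  let μ : Plane → ℝ := fun e => -e 0 / (e 1 - τ * e 0)
  have hK : ∀ m ∈ F.image μ, (V.image fun v => v.2 - m * v.1).card ≤ ⌊(P.card : ℝ) ^ s⌋₊ := by
    intro m hm
    obtain ⟨e, he, rfl⟩ := Finset.mem_image.1 hm
    have hβe := hβ e he
    refine le_trans ?_ (Nat.le_floor (hF he).2)
    rw [show (V.image fun v => v.2 - μ e * v.1)
        = (projSet P e).image fun t => t / (e 1 - τ * e 0) from ?_]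
    · exact Finset.card_image_le
    · rw [projSet, Finset.image_image, Finset.image_image]
      refine Finset.image_congr fun x _ => ?_
      simp only [Function.comp, proj_eq, μ]
      rw [eq_div_iff hβe, sub_mul, mul_right_comm, div_mul_cancel₀ _ hβe]
      ring
  have hFM : F.card ≤ 2 * (F.image μ).card := by
    refine Finset.card_le_mul_card_image F 2 fun m hm => ?_
    obtain ⟨e, he, rfl⟩ := Finset.mem_image.1 hm
    refine (Finset.card_le_card (t := {e, -e}) fun f hf => ?_).trans Finset.card_le_two
    obtain ⟨hfF, hfe⟩ := Finset.mem_filter.1 hf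
    simp only [μ] at hfe
    rw [div_eq_div_iff (hβ f hfF) (hβ e he)] at hfe
    simpa using eq_or_eq_neg_of_mul_eq (hF hfF).1 (hF he).1 (by linarith)
  have hfloor := Nat.floor_le (Real.rpow_nonneg hn0.le s)
  have hM := IsSegmentGraph.card_slopes_le hV hδ0 (by omega)
    (by rw [hVcard]; exact hfloor.trans hns) hK
  have hpow : (⌊(P.card : ℝ) ^ s⌋₊ : ℝ) ^ 2 / V.card ≤ (P.card : ℝ) ^ (2 * s - 1) := by
    rw [hVcard, Real.rpow_sub_one hn0.ne', mul_comm 2 s, Real.rpow_mul hn0.le, Real.rpow_two]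
    gcongr
  -- This is where s ≥ 1/2 enters: the alternative with boundedly many slopes is absorbed.
  have hone : 1 ≤ (P.card : ℝ) ^ (2 * s - 1) := Real.one_le_rpow (by linarith) (by linarith)
  have ha : 0 < 6 / δ := by positivity
  have hb : 0 < 72 / δ ^ 3 := by positivity
  have hM' : ((F.image μ).card : ℝ) ≤ (6 / δ + 72 / δ ^ 3) * (P.card : ℝ) ^ (2 * s - 1) := by
    rcases hM with h | h
    · nlinarith
    · have := mul_le_mul_of_nonneg_left hpow hb.le
      nlinarith
  have hFM' : (F.card : ℝ) ≤ 2 * (F.image μ).card := by exact_mod_cast hFM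
  linarith

theorem proposition1p10 (s : ℝ) (hs : 1 / 2 ≤ s) (hs' : s < 1) :
    ∃ C : ℝ, 1 ≤ C ∧ ∀ P : Finset Plane, 2 ≤ P.card →
      (smallProjDirections P s).Finite ∧
        ((smallProjDirections P s).ncard : ℝ) ≤ C * (P.card : ℝ) ^ (2 * s - 1) := by
  -- For n ≥ 2, n^s = n^(s-1) · n ≤ 2^(s-1) · n, which is (1 - δ)n.
  obtain ⟨δ, hδ⟩ : ∃ δ : ℝ, δ = 1 - 2 ^ (s - 1) := ⟨_, rfl⟩
  have hδ0 : 0 < δ := by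
    have := Real.rpow_lt_one_of_one_lt_of_neg one_lt_two (sub_neg.2 hs')
    linarith
  have hδ1 : δ ≤ 1 := by
    have := Real.rpow_nonneg zero_le_two (s - 1)
    linarith
  refine ⟨2 * (6 / δ + 72 / δ ^ 3), ?_, fun P hP => ?_⟩
  · have h1 : 1 ≤ 6 / δ := by rw [le_div_iff₀ hδ0]; linarith
    have h2 : 0 < 72 / δ ^ 3 := by positivity
    linarith
  have hfin : (smallProjDirections P s).Finite := by
    by_contra hinf
    obtain ⟨N, hN⟩ := exists_nat_gt (2 * (6 / δ + 72 / δ ^ 3) * (P.card : ℝ) ^ (2 * s - 1))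
    obtain ⟨F, hF, hFN⟩ := Set.Infinite.exists_subset_card_eq hinf N
    have := card_directions_le hs hδ hδ0 hP F hF
    rw [hFN] at this
    linarith
  refine ⟨hfin, ?_⟩
  rw [Set.ncard_eq_toFinset_card _ hfin]
  exact card_directions_le hs hδ hδ0 hP _ (by simp)
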